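/- Let $l \ge d \ge 19$ be integers, and let $$\Lambda(d,l) = \left(\frac{\pi d}{8e^2}\right)^{d\left(\frac{l+d}{d}\right)^d}\left(\left(\frac{l+d}{d}\right)^d-1\right)^{\left(\frac{l+d}{d}\right)^d-1}\frac{1}{(l+d)^{3l\left(\frac{e(l+d)}{d}\right)^d}} .$$ Then $\Lambda(d,l) > 0$. Let $c \ge b > 0$, and let $K:\mathbb{R}\to\mathbb{R}$ be a kernel with $b \le K(t) \le c$ for $t\in[-1,1]$ and $K(t)=0$ for $t\notin[-1,1]$. For $u\in\mathbb{R}^d$ let $U(u) = \left(\frac{u^s}{s!}\right)_{s}$ be the vector of length $D=\binom{l+d}{d}$ indexed by the multi-indices $s\in\mathbb{Z}_{\ge 0}^d$ with $s_1+\dots+s_d\le l$, where $u^s=\prod_i u_i^{s_i}$ and $s!=\prod_i s_i!$. For an integer $m\ge1$ let $\mathcal{G}_m=\{1/m,2/m,\dots,1\}^d$, and for $h\in(0,\frac12)$ and $x\in[h,1-h]^d$ let $$B(x)=\frac{1}{(mh)^d}\sum_{y\in\mathcal{G}_m}U\!\left(\frac{y-x}{h}\right)U\!\left(\frac{y-x}{h}\right)^{\!\mathrm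 T}\prod_{j=1}^dK\!\left(\frac{y_j-x_j}{h}\right)\in\mathbb{R}^{D\times D}.$$ Then, for all integers $m\ge 1$ and all $h\in(0,\frac12)$ such that $mh\ge 4l(3e)^d/\Lambda(d,l)$, and all $x\in[h,1-h]^d$, $$B(x)\succeq\frac{b^d\Lambda(d,l)}{2}\,I_D,$$ that is, the symmetric matrix $B(x)-\frac{b^d\Lambda(d,l)}{2}I_D$ is positive semidefinite. -/

import Mathlib

namespace LocalPoly

/-- Multi-indices `s ∈ ℤ₊^d` with `|s| = s₁ + ⋯ + s_d ≤ l`. They index the entries of `U` and the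
rows and columns of `B(x)`, so they play the role of the index set of size `D`. -/
abbrev MultiIndex (d l : ℕ) : Type := {s : Fin d → ℕ // ∑ i, s i ≤ l}

theorem mem_multiIndex_filter (d l : ℕ) (s : Fin d → ℕ) :
    s ∈ (Fintype.piFinset fun _ : Fin d => Finset.range (l + 1)).filter (fun s => ∑ i, s i ≤ l) ↔
      ∑ i, s i ≤ l := by
  simp only [Finset.mem_filter, Fintype.mem_piFinset, Finset.mem_range, and_iff_right_iff_imp]
  intro h i
  have := Finset.single_le_sum (f := s) (fun j _ => Nat.zero_le (s j)) (Finset.mem_univ i)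
  omega

instance instFintypeMultiIndex (d l : ℕ) : Fintype (MultiIndex d l) :=
  Fintype.subtype
    ((Fintype.piFinset fun _ : Fin d => Finset.range (l + 1)).filter (fun s => ∑ i, s i ≤ l))
    (mem_multiIndex_filter d l)

noncomputable section

/-- `K : ℝ → ℝ` is (the extension by zero of) a kernel `[-1,1] → [b,c]` with `c ≥ b > 0`;
its support is `[-1,1]`. -/
structure IsKernel (b c : ℝ) (K : ℝ → ℝ) : Prop where
  b_pos : 0 < b
  b_le_c : b ≤ c
  bounds : ∀ t ∈ Set.Icc (-1 : ℝ) 1, K t ∈ Set.Icc b c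
  support_eq : Function.support K = Set.Icc (-1 : ℝ) 1

/-- The uniform grid `{1/m, 2/m, …, 1}^d ⊆ [0,1]^d`. -/
def grid (d m : ℕ) : Finset (Fin d → ℝ) :=
  Fintype.piFinset fun _ => (Finset.Icc 1 m).image fun k : ℕ => (k : ℝ) / m

/-- The grid consists of the `u ∈ [0,1]^d` with `uᵢ m ∈ {1, …, m}` for all `i`. -/
theorem mem_grid_iff {d m : ℕ} (hm : 1 ≤ m) (u : Fin d → ℝ) :
    u ∈ grid d m ↔ (∀ i, u i ∈ Set.Icc (0 : ℝ) 1) ∧ ∀ i, ∃ k ∈ Finset.Icc 1 m, u i * m = (k : ℝ) := by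
  have hm' : (0 : ℝ) < m := by exact_mod_cast hm
  simp only [grid, Fintype.mem_piFinset, Finset.mem_image]
  constructor
  · intro h
    refine ⟨fun i => ?_, fun i => ?_⟩
    · obtain ⟨k, hk, hki⟩ := h i
      have hk2 : (k : ℝ) ≤ m := by exact_mod_cast (Finset.mem_Icc.1 hk).2
      rw [← hki]
      exact ⟨by positivity, (div_le_one hm').2 hk2⟩
    · obtain ⟨k, hk, hki⟩ := h i
      exact ⟨k, hk, by rw [← hki]; field_simp⟩
  · rintro ⟨-, h⟩ i
    obtain ⟨k, hk, hki⟩ := h i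
    exact ⟨k, hk, by rw [← hki]; field_simp⟩

/-- The vector `U(u) = (u^s / s!)_{|s| ≤ l}`, with `u^s = ∏ᵢ uᵢ^{sᵢ}` and `s! = ∏ᵢ sᵢ!`. -/
def U (d l : ℕ) (u : Fin d → ℝ) : MultiIndex d l → ℝ :=
  fun s => (∏ i, u i ^ s.1 i) / ∏ i, ((s.1 i).factorial : ℝ)

/-- The design matrix
`B(x) = (m h)^{-d} ∑_{y ∈ grid} (∏_j K((y_j - x_j)/h)) U((y - x)/h) U((y - x)/h)ᵀ`. -/
def B (d l m : ℕ) (K : ℝ → ℝ) (h : ℝ) (x : Fin d → ℝ) :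
    Matrix (MultiIndex d l) (MultiIndex d l) ℝ :=
  (1 / ((m : ℝ) * h) ^ d) • ∑ y ∈ grid d m,
    (∏ j, K ((y j - x j) / h)) •
      Matrix.vecMulVec (U d l fun j => (y j - x j) / h) (U d l fun j => (y j - x j) / h)

/-- The constant `Λ(d,l)`. The inner powers `((l+d)/d)^d` are natural-number powers of reals, the
outer ones are real powers. -/
def Lam (d l : ℕ) : ℝ :=
  (Real.pi * d / (8 * Real.exp 1 ^ 2)) ^ ((d : ℝ) * (((l : ℝ) + d) / d) ^ d) *
    ((((l : ℝ) + d) / d) ^ d - 1) ^ ((((l : ℝ) + d) / d) ^ d - 1) *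
    (1 / ((l : ℝ) + d) ^ (3 * (l : ℝ) * (Real.exp 1 * ((l : ℝ) + d) / d) ^ d))

end

end LocalPoly

open Finset Polynomial

namespace LocalPoly

/-! The quadratic form of `B` at `v` is a weighted sum of squares of a polynomial over a product
grid. Extending `v` by zero to `{0, …, l}^d` makes everything factor over coordinates, so `B` is a
principal submatrix of a Kronecker product of univariate design matrices, and a univariate lower
bound gives its `d`-th power (`tensor_lower_bound`). In one variable, put `n = l + 1`. The window of
radius `h` around `x` contains about `m * h / n` or more disjoint `n`-tuples of grid points whose
rescaled gaps are at least `1 / n`. On each tuple, Lagrange interpolation recovers the coefficients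
from the values (`sum_sq_le_sum_sq_eval`); adding up the tuples gives `univariate_lower_bound`. The
resulting constant already dominates `Lam` (`Lam_le`), so no limiting integral is needed. -/

/-! ### Coefficients from values at separated nodes -/

/-- Each factor `a * (X - u)` with `|u| ≤ 1` enlarges a uniform coefficient bound by at most `2 *
A`. -/
theorem abs_coeff_prod_linear_le {ι : Type*} (T : Finset ι) (a u : ι → ℝ) {A : ℝ}
    (hA : 0 ≤ A) (ha : ∀ i ∈ T, |a i| ≤ A) (hu : ∀ i ∈ T, |u i| ≤ 1) (k : ℕ) :
    |(∏ i ∈ T, C (a i) * (X - C (u i))).coeff k| ≤ (2 * A) ^ #T := by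
  classical
  induction T using Finset.induction_on generalizing k with
  | empty =>
    simp only [prod_empty, card_empty, pow_zero, coeff_one]
    split_ifs <;> simp
  | insert i T hi ih =>
    have ih' := ih (fun j hj => ha j (mem_insert_of_mem hj))
      (fun j hj => hu j (mem_insert_of_mem hj))
    rw [prod_insert hi, card_insert_of_notMem hi, mul_assoc, coeff_C_mul, sub_mul, coeff_sub,
      coeff_C_mul, abs_mul]
    have h1 : |(X * ∏ i ∈ T, C (a i) * (X - C (u i))).coeff k| ≤ (2 * A) ^ #T := by
      cases k with
      | zero => simpa using by positivity
      | succ k => simpa [coeff_X_mul] using ih' k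
    have h2 : |u i * (∏ i ∈ T, C (a i) * (X - C (u i))).coeff k| ≤ (2 * A) ^ #T := by
      rw [abs_mul]
      exact (mul_le_of_le_one_left (abs_nonneg _) (hu i (mem_insert_self _ _))).trans (ih' k)
    calc _ ≤ A * ((2 * A) ^ #T + (2 * A) ^ #T) :=
          mul_le_mul (ha i (mem_insert_self _ _)) ((abs_sub _ _).trans (add_le_add h1 h2))
            (abs_nonneg _) hA
      _ = (2 * A) ^ (#T + 1) := by ring

/-- Coefficients of a polynomial are controlled by its values at nodes of `[-1, 1]` whose mutual
distances are at least `1 / N`. -/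
theorem abs_coeff_le_sum_abs_eval {n : ℕ} {N : ℝ} (hN : 0 < N) (p : ℝ[X]) (hp : p.degree < n)
    (u : Fin n → ℝ) (hu : ∀ i, |u i| ≤ 1) (hsep : ∀ i j, i ≠ j → 1 / N ≤ |u i - u j|) (k : ℕ) :
    |p.coeff k| ≤ (2 * N) ^ (n - 1) * ∑ i, |p.eval (u i)| := by
  have hinj : Function.Injective u := by
    intro i j hij
    by_contra hne
    have := hsep i j hne
    rw [hij, sub_self, abs_zero] at this
    exact absurd this (not_le.2 (by positivity))
  have hpe := Lagrange.eq_interpolate (s := univ) (v := u) (f := p) hinj.injOn (by simpa using hp)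
  conv_lhs => rw [hpe]
  rw [Lagrange.interpolate_apply, finsetSum_coeff, mul_sum]
  refine (abs_sum_le_sum_abs _ _).trans (sum_le_sum fun i _ => ?_)
  rw [coeff_C_mul, abs_mul, mul_comm]
  refine mul_le_mul_of_nonneg_right ?_ (abs_nonneg _)
  -- A Lagrange basis polynomial is a product of `n - 1` linear factors with slopes `(u i - u j)⁻¹`,
  -- of size at most `N`.
  have h := abs_coeff_prod_linear_le (univ.erase i) (fun j => (u i - u j)⁻¹) u hN.le
    (fun j hj => by
      rw [abs_inv]
      refine inv_le_of_inv_le₀ hN ?_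
      rw [← one_div]
      exact hsep i j (ne_of_mem_erase hj).symm) (fun j _ => hu j) k
  simpa [Lagrange.basis, Lagrange.basisDivisor] using h

/-- The exponent collects `2(n-1)` from the squared factorials, `2(n-1)` from squared interpolation
with `N = n`, and one each from Cauchy–Schwarz and the sum over `s`. -/
theorem sum_sq_le_sum_sq_eval {n : ℕ} (hn : 0 < n) (v : Fin n → ℝ)
    (u : Fin n → ℝ) (hu : ∀ i, |u i| ≤ 1)
    (hsep : ∀ i j, i ≠ j → 1 / (n : ℝ) ≤ |u i - u j|) :
    ∑ s, v s ^ 2 ≤ (2 * n : ℝ) ^ (4 * n - 2) *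
      ∑ i, (∑ s, v s * (u i ^ (s : ℕ) / (s : ℕ).factorial)) ^ 2 := by
  have hn' : (0 : ℝ) < n := by exact_mod_cast hn
  have hn1 : (1 : ℝ) ≤ n := by exact_mod_cast hn
  set p : ℝ[X] := ∑ s : Fin n, C (v s / (s : ℕ).factorial) * X ^ (s : ℕ) with hpdef
  have heval : ∀ x, p.eval x = ∑ s, v s * (x ^ (s : ℕ) / (s : ℕ).factorial) := by
    intro x
    simp only [hpdef, eval_finsetSum, eval_mul, eval_C, eval_pow, eval_X]
    exact sum_congr rfl fun s _ => by ring
  have hdeg : p.degree < n := by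
    refine (degree_sum_le _ _).trans_lt ((Finset.sup_lt_iff (WithBot.bot_lt_coe n)).2 fun s _ => ?_)
    exact (degree_C_mul_X_pow_le _ _).trans_lt (WithBot.coe_lt_coe.2 (Nat.cast_lt.2 s.2))
  have hcoeff : ∀ s : Fin n, p.coeff s = v s / (s : ℕ).factorial := by
    intro s
    simp only [hpdef, finsetSum_coeff, coeff_C_mul, coeff_X_pow, Fin.val_inj]
    simp
  simp_rw [← heval]
  set Q := ∑ i, p.eval (u i) ^ 2
  have hQ : 0 ≤ Q := sum_nonneg fun _ _ => sq_nonneg _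
  have hv : ∀ s : Fin n, v s ^ 2 ≤ (n : ℝ) ^ (2 * (n - 1)) * (2 * n : ℝ) ^ (2 * (n - 1)) * (n * Q) := by
    intro s
    have hf : ((s : ℕ).factorial : ℝ) ≤ (n : ℝ) ^ (n - 1) := by
      have h1 : (s : ℕ).factorial ≤ (n - 1).factorial := Nat.factorial_le (by omega)
      have h2 : (n - 1).factorial ≤ (n - 1) ^ (n - 1) := Nat.factorial_le_pow _
      have h3 : (n - 1) ^ (n - 1) ≤ n ^ (n - 1) := Nat.pow_le_pow_left (by omega) _
      exact_mod_cast h1.trans (h2.trans h3)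
    have hf0 : (0 : ℝ) < (s : ℕ).factorial := by positivity
    have hb := abs_coeff_le_sum_abs_eval hn' p hdeg u hu hsep s
    have hcs : (∑ i, |p.eval (u i)|) ^ 2 ≤ n * Q := by
      simpa using sq_sum_le_card_mul_sum_sq (s := univ) (f := fun i => |p.eval (u i)|)
    have hvs : v s = (s : ℕ).factorial * p.coeff s := by rw [hcoeff]; field_simp
    calc v s ^ 2 = ((s : ℕ).factorial : ℝ) ^ 2 * |p.coeff s| ^ 2 := by rw [hvs, sq_abs, mul_pow]
      _ ≤ ((n : ℝ) ^ (n - 1)) ^ 2 * ((2 * n : ℝ) ^ (n - 1) * ∑ i, |p.eval (u i)|) ^ 2 := by gcongr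
      _ = (n : ℝ) ^ (2 * (n - 1)) * (2 * n : ℝ) ^ (2 * (n - 1)) * (∑ i, |p.eval (u i)|) ^ 2 := by
        ring
      _ ≤ _ := by gcongr
  calc ∑ s, v s ^ 2
      ≤ ∑ _s : Fin n, (n : ℝ) ^ (2 * (n - 1)) * (2 * n : ℝ) ^ (2 * (n - 1)) * (n * Q) :=
        sum_le_sum fun s _ => hv s
    _ = (n : ℝ) ^ (2 * (n - 1)) * (2 * n : ℝ) ^ (2 * (n - 1)) * (n : ℝ) ^ 2 * Q := by
        rw [sum_const, card_univ, Fintype.card_fin, nsmul_eq_mul]; ring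
    _ ≤ (2 * n : ℝ) ^ (2 * (n - 1)) * (2 * n : ℝ) ^ (2 * (n - 1)) * (2 * n : ℝ) ^ 2 * Q := by
        gcongr <;> linarith
    _ = (2 * n : ℝ) ^ (4 * n - 2) * Q := by
        rw [← pow_add, ← pow_add]; congr 2; omega

/-! ### The univariate design matrix -/

/-- A lower bound for the univariate design matrix. -/
theorem univariate_lower_bound {n m : ℕ} (hn : 0 < n) {b h x : ℝ} {K : ℝ → ℝ} (hm : 0 < m)
    (hb : 0 ≤ b) (hK : ∀ t, 0 ≤ K t) (hKb : ∀ t ∈ Set.Icc (-1 : ℝ) 1, b ≤ K t) (hh : 0 < h)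
    (hnm : (n : ℝ) ≤ m * h) (hx : x ∈ Set.Icc h (1 - h)) (v : Fin n → ℝ) :
    b * (m * h) / (2 * n : ℝ) ^ (4 * n - 1) * ∑ s, v s ^ 2 ≤
      ∑ y ∈ (Icc 1 m).image (fun k : ℕ => (k : ℝ) / m), K ((y - x) / h) *
        (∑ s : Fin n, v s * (((y - x) / h) ^ (s : ℕ) / (s : ℕ).factorial)) ^ 2 := by
  have hm' : (0 : ℝ) < m := by exact_mod_cast hm
  have hn' : (0 : ℝ) < n := by exact_mod_cast hn
  have hmh : 0 < m * h := by positivity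
  rw [sum_image (by
    intro i _ j _ hij
    have : (i : ℝ) = j := by simpa [div_left_inj' hm'.ne'] using hij
    exact_mod_cast this)]
  set F : ℕ → ℝ := fun k => K (((k : ℝ) / m - x) / h) *
    (∑ s : Fin n, v s * ((((k : ℝ) / m - x) / h) ^ (s : ℕ) / (s : ℕ).factorial)) ^ 2
  have hF : ∀ k, 0 ≤ F k := fun k => mul_nonneg (hK _) (sq_nonneg _)
  -- The first index strictly right of `m * (x - h)`; the `+ 1` also ensures `k₀ ≥ 1`.
  set k₀ := ⌊m * (x - h)⌋₊ + 1
  have hk0 : m * (x - h) < k₀ := by simpa [k₀] using Nat.lt_floor_add_one (m * (x - h))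
  have hk1 : (k₀ : ℝ) ≤ m * (x - h) + 1 := by
    have := Nat.floor_le (a := m * (x - h)) (mul_nonneg hm'.le (by linarith [hx.1]))
    simpa [k₀] using this
  -- `M` is both the number of tuples and the index stride inside each: tuple `t` is `k₀ + t + M *
  -- i`, `i < n`.
  set M := ⌊2 * (m * h) / n⌋₊
  have hM1 : (M : ℝ) * n ≤ 2 * (m * h) := by
    have := Nat.floor_le (a := 2 * (m * h) / n) (by positivity)
    rwa [le_div_iff₀ hn'] at this
  have hM2 : m * h / n ≤ M := by
    have h1 := (Nat.lt_floor_add_one (2 * (m * h) / n)).le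
    have h2 : 1 ≤ m * h / n := (one_le_div hn').2 hnm
    have h3 : 2 * (m * h) / n = 2 * (m * h / n) := by ring
    change 2 * (m * h) / n ≤ (M : ℝ) + 1 at h1
    linarith
  have hidx : ∀ i t : ℕ, i < n → t < M → ((k₀ + (t + M * i) : ℕ) : ℝ) ≤ m * (x + h) := by
    intro i t hi ht
    -- The spare `1` absorbs the rounding in `k₀ ≤ m * (x - h) + 1`.
    have h1 : t + M * i + 1 ≤ M * n := by nlinarith
    have h2 : (t + M * i + 1 : ℝ) ≤ M * n := by exact_mod_cast h1
    push_cast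
    linarith
  have hle : ∑ q ∈ range M ×ˢ (univ : Finset (Fin n)), F (k₀ + (q.1 + M * q.2)) ≤
      ∑ k ∈ Icc 1 m, F k := by
    -- Distinct tuples lie in distinct residue classes modulo `M`.
    have hinj : Set.InjOn (fun q : ℕ × Fin n => k₀ + (q.1 + M * q.2))
        (range M ×ˢ (univ : Finset (Fin n)) : Finset _) := by
      rintro ⟨t, i⟩ hq ⟨t', i'⟩ hq' heq
      simp only [coe_product, Set.mem_prod, mem_coe, mem_range, mem_univ, and_true] at hq hq'
      have heq' : t + M * (i : ℕ) = t' + M * (i' : ℕ) := by simpa using heq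
      have ht : t = t' := by
        have := congrArg (· % M) heq'
        simpa [Nat.mod_eq_of_lt hq, Nat.mod_eq_of_lt hq'] using this
      subst ht
      have hi : (i : ℕ) = i' := Nat.eq_of_mul_eq_mul_left (by omega : 0 < M) (by omega)
      rw [Fin.ext hi]
    rw [← sum_image (f := F) hinj]
    refine sum_le_sum_of_subset_of_nonneg ?_ fun k _ _ => hF k
    intro k hk
    obtain ⟨⟨t, i⟩, hq, rfl⟩ := mem_image.1 hk
    simp only [mem_product, mem_range, mem_univ, and_true] at hq
    refine mem_Icc.2 ⟨by simp only [k₀]; omega, ?_⟩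
    have h1 := hidx i t i.2 hq
    have h2 : m * (x + h) ≤ m := by nlinarith [hx.2]
    exact_mod_cast h1.trans h2
  refine le_trans ?_ hle
  rw [sum_product]
  have htuple : ∀ t ∈ range M, b / (2 * n : ℝ) ^ (4 * n - 2) * ∑ s, v s ^ 2 ≤
      ∑ i : Fin n, F (k₀ + (t + M * i)) := by
    intro t ht
    rw [mem_range] at ht
    set u : Fin n → ℝ := fun i => (((k₀ + (t + M * i) : ℕ) : ℝ) / m - x) / h with hu
    have hu1 : ∀ i, u i ∈ Set.Icc (-1 : ℝ) 1 := by
      intro i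
      have h1 := hidx i t i.2 ht
      have h2 : m * (x - h) ≤ ((k₀ + (t + M * i) : ℕ) : ℝ) := by
        push_cast
        have : (0 : ℝ) ≤ t + M * (i : ℕ) := by positivity
        linarith
      rw [← div_le_iff₀' hm'] at h1
      rw [← le_div_iff₀' hm'] at h2
      simp only [hu, Set.mem_Icc]
      rw [le_div_iff₀ hh, div_le_iff₀ hh]
      constructor <;> linarith
    have hsep : ∀ i j, i ≠ j → 1 / (n : ℝ) ≤ |u i - u j| := by
      intro i j hij
      have h1 : u i - u j = M / (m * h) * (((i : ℕ) : ℤ) - ((j : ℕ) : ℤ) : ℤ) := by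
        simp only [hu]
        push_cast
        field_simp
        ring
      have h2 : (1 : ℝ) ≤ |((((i : ℕ) : ℤ) - ((j : ℕ) : ℤ) : ℤ) : ℝ)| := by
        rw [← Int.cast_abs]
        have : (((i : ℕ) : ℤ) - ((j : ℕ) : ℤ)) ≠ 0 := by
          intro h0
          exact hij (Fin.ext (by omega))
        exact_mod_cast Int.one_le_abs this
      rw [h1, abs_mul, abs_of_nonneg (by positivity : (0 : ℝ) ≤ M / (m * h))]
      have h3 : 1 / (n : ℝ) ≤ M / (m * h) := by
        rw [div_le_div_iff₀ hn' hmh]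
        rw [div_le_iff₀ hn'] at hM2
        linarith
      exact h3.trans (le_mul_of_one_le_right (by positivity) h2)
    have hkey := sum_sq_le_sum_sq_eval hn v u (fun i => abs_le.2 (hu1 i)) hsep
    calc b / (2 * n : ℝ) ^ (4 * n - 2) * ∑ s, v s ^ 2
        ≤ b / (2 * n : ℝ) ^ (4 * n - 2) * ((2 * n : ℝ) ^ (4 * n - 2) *
          ∑ i, (∑ s, v s * (u i ^ (s : ℕ) / (s : ℕ).factorial)) ^ 2) := by gcongr
      _ = b * ∑ i, (∑ s, v s * (u i ^ (s : ℕ) / (s : ℕ).factorial)) ^ 2 := by field_simp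
      _ ≤ _ := by
        rw [mul_sum]
        exact sum_le_sum fun i _ => mul_le_mul_of_nonneg_right (hKb _ (hu1 i)) (sq_nonneg _)
  refine le_trans ?_ (sum_le_sum htuple)
  rw [sum_const, card_range, nsmul_eq_mul, ← mul_assoc (M : ℝ)]
  refine mul_le_mul_of_nonneg_right ?_ (sum_nonneg fun s _ => sq_nonneg (v s))
  calc b * (m * h) / (2 * n : ℝ) ^ (4 * n - 1)
      = m * h / (2 * n) * (b / (2 * n : ℝ) ^ (4 * n - 2)) := by
        rw [show 4 * n - 1 = (4 * n - 2) + 1 by omega, pow_succ]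
        field_simp
    _ ≤ M * (b / (2 * n : ℝ) ^ (4 * n - 2)) := by
        refine mul_le_mul_of_nonneg_right (le_trans ?_ hM2) (by positivity)
        gcongr
        linarith

/-! ### Tensorization -/

theorem sum_fin_succ_pi {β : Type*} [Fintype β] {d : ℕ} (g : (Fin (d + 1) → β) → ℝ) :
    ∑ s, g s = ∑ a : β, ∑ t : Fin d → β, g (Fin.cons a t) := by
  rw [← (Fin.consEquiv fun _ : Fin (d + 1) => β).sum_comp, Fintype.sum_prod_type]
  rfl

/-- Lower bounds for quadratic forms pass to products. -/
theorem tensor_lower_bound {α σ : Type*} [Fintype α] [Fintype σ] {μ : ℝ} (hμ : 0 ≤ μ) {d : ℕ}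
    (w : Fin d → α → ℝ) (f : Fin d → σ → α → ℝ) (hw : ∀ j a, 0 ≤ w j a)
    (hf : ∀ j (v : σ → ℝ), μ * ∑ s, v s ^ 2 ≤ ∑ a, w j a * (∑ s, v s * f j s a) ^ 2)
    (v : (Fin d → σ) → ℝ) :
    μ ^ d * ∑ s, v s ^ 2 ≤
      ∑ y : Fin d → α, (∏ j, w j (y j)) * (∑ s, v s * ∏ j, f j (s j) (y j)) ^ 2 := by
  induction d with
  | zero => simp
  | succ d ih =>
    rw [sum_fin_succ_pi (β := α), sum_fin_succ_pi (β := σ)]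
    -- With the first grid coordinate frozen at `a`, induction applies to `v` contracted against `f
    -- 0 · a`.
    have h1 : ∀ a : α, w 0 a * (μ ^ d * ∑ t : Fin d → σ, (∑ s, v (Fin.cons s t) * f 0 s a) ^ 2) ≤
        ∑ y : Fin d → α, (∏ j, w j ((Fin.cons a y : Fin (d + 1) → α) j)) *
          (∑ s, v s * ∏ j, f j (s j) ((Fin.cons a y : Fin (d + 1) → α) j)) ^ 2 := by
      intro a
      refine (mul_le_mul_of_nonneg_left (ih (fun j => w j.succ) (fun j => f j.succ)
        (fun j => hw j.succ) (fun j => hf j.succ) fun t => ∑ s, v (Fin.cons s t) * f 0 s a)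
        (hw 0 a)).trans_eq ?_
      rw [mul_sum]
      refine sum_congr rfl fun y _ => ?_
      rw [Fin.prod_univ_succ, sum_fin_succ_pi (β := σ), sum_comm, mul_assoc]
      simp only [Fin.prod_univ_succ, Fin.cons_zero, Fin.cons_succ, sum_mul, mul_assoc]
    refine le_trans ?_ (sum_le_sum fun a _ => h1 a)
    calc μ ^ (d + 1) * ∑ s, ∑ t : Fin d → σ, v (Fin.cons s t) ^ 2
        = μ ^ d * ∑ t : Fin d → σ, μ * ∑ s, v (Fin.cons s t) ^ 2 := by
          rw [sum_comm, ← mul_sum]; ring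
      _ ≤ μ ^ d * ∑ t : Fin d → σ, ∑ a, w 0 a * (∑ s, v (Fin.cons s t) * f 0 s a) ^ 2 := by
          gcongr with t _
          exact hf 0 fun s => v (Fin.cons s t)
      _ = _ := by
          rw [sum_comm, mul_sum]
          refine sum_congr rfl fun a _ => ?_
          rw [← mul_sum]; ring

/-! ### Estimates for `Λ` -/

theorem Lam_pos {d l : ℕ} (hd : 0 < d) (hl : 0 < l) : 0 < Lam d l := by
  have hd' : (0 : ℝ) < d := by exact_mod_cast hd
  have hl' : (0 : ℝ) < l := by exact_mod_cast hl
  have h1 : 1 < (((l : ℝ) + d) / d) ^ d := one_lt_pow₀ (by rw [one_lt_div hd']; linarith) hd.ne'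
  unfold Lam
  refine mul_pos (mul_pos (Real.rpow_pos_of_pos (by positivity) _)
    (Real.rpow_pos_of_pos (by linarith) _)) (by positivity)

/-- The first two factors of `Lam` are at most `S ^ (d * n)` in total, where `S = l + d` and `n = (S
/ d) ^ d`; the denominator's exponent, carrying `e ^ d`, beats this and the target exponent
together. -/
theorem Lam_le {d l : ℕ} (hd : 19 ≤ d) (hl : d ≤ l) :
    Lam d l ≤ 1 / ((2 * (l + 1 : ℕ) : ℝ) ^ (4 * (l + 1) - 1)) ^ d := by
  have hd1 : (19 : ℝ) ≤ d := by exact_mod_cast hd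
  have hdl : (d : ℝ) ≤ l := by exact_mod_cast hl
  have hd' : (0 : ℝ) < d := by linarith
  have he1 : (2 : ℝ) ≤ Real.exp 1 := by linarith [Real.add_one_le_exp 1]
  unfold Lam
  set S : ℝ := (l : ℝ) + d with hS
  have hS1 : 1 ≤ S := by linarith
  have hS0 : 0 < S := by linarith
  set n : ℝ := (S / d) ^ d with hn
  have hr : 1 ≤ S / d := by rw [one_le_div hd']; linarith
  have hn1 : 1 ≤ n := one_le_pow₀ hr
  have hE : (Real.exp 1 * S / d) ^ d = Real.exp 1 ^ d * n := by rw [hn, ← mul_pow, mul_div_assoc]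
  rw [hE]
  set E : ℝ := Real.exp 1 ^ d
  -- The `7` is chosen so that `2 * 7 * l * d` covers `(8 * l + 6) * d` in `hexp`.
  have hEd : 7 * (d : ℝ) ≤ E := by
    have h7 : 7 * d ≤ 2 ^ d := by
      clear * - hd
      induction d, hd using Nat.le_induction with
      | base => norm_num
      | succ k hk ih => rw [pow_succ]; omega
    have h2 : (2 : ℝ) ^ d ≤ E := pow_le_pow_left₀ (by norm_num) he1 d
    have h7' : 7 * (d : ℝ) ≤ 2 ^ d := by exact_mod_cast h7
    exact h7'.trans h2
  have hf1 : (Real.pi * d / (8 * Real.exp 1 ^ 2)) ^ ((d : ℝ) * n) ≤ (d : ℝ) ^ ((d : ℝ) * n) := by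
    refine Real.rpow_le_rpow (by positivity) ?_ (by positivity)
    rw [div_le_iff₀ (by positivity), mul_comm]
    refine mul_le_mul_of_nonneg_left ?_ hd'.le
    nlinarith [Real.pi_le_four, sq_nonneg (Real.exp 1 - 2)]
  have hf2 : (n - 1) ^ (n - 1) ≤ (S / d) ^ ((d : ℝ) * n) := by
    calc (n - 1) ^ (n - 1) ≤ n ^ (n - 1) :=
          Real.rpow_le_rpow (by linarith) (by linarith) (by linarith)
      _ ≤ n ^ n := Real.rpow_le_rpow_of_exponent_le hn1 (by linarith)
      _ = (S / d) ^ ((d : ℝ) * n) := by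
        rw [Real.rpow_mul (by positivity), Real.rpow_natCast]
  have hbase : ((2 * (l + 1 : ℕ) : ℝ) ^ (4 * (l + 1) - 1)) ^ d ≤
      S ^ (2 * (4 * (l : ℝ) + 3) * d) := by
    have h1 : ((2 * (l + 1 : ℕ) : ℝ)) ≤ S ^ 2 := by push_cast; nlinarith
    calc ((2 * (l + 1 : ℕ) : ℝ) ^ (4 * (l + 1) - 1)) ^ d
        ≤ ((S ^ 2) ^ (4 * (l + 1) - 1)) ^ d := by gcongr
      _ = S ^ (2 * (4 * (l : ℝ) + 3) * d) := by
        rw [← pow_mul, ← pow_mul, ← Real.rpow_natCast, show 4 * (l + 1) - 1 = 4 * l + 3 by omega]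
        push_cast
        congr 1
        ring
  have hexp : d * n + 2 * (4 * (l : ℝ) + 3) * d ≤ 3 * l * (E * n) := by
    have hEn : 7 * (d : ℝ) ≤ E * n := hEd.trans (le_mul_of_one_le_right (by linarith) hn1)
    have h1 : (d : ℝ) * n ≤ l * (E * n) := by
      refine mul_le_mul hdl (le_mul_of_one_le_left (by linarith) (by linarith)) (by linarith)
        (by linarith)
    have h2 : l * (7 * (d : ℝ)) ≤ l * (E * n) := by gcongr
    nlinarith
  calc _ ≤ (d : ℝ) ^ ((d : ℝ) * n) * (S / d) ^ ((d : ℝ) * n) * (1 / S ^ (3 * l * (E * n))) := by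
        gcongr
    _ = S ^ ((d : ℝ) * n) / S ^ (3 * l * (E * n)) := by
        rw [← Real.mul_rpow hd'.le (by positivity), mul_div_cancel₀ _ hd'.ne', mul_one_div]
    _ ≤ 1 / S ^ (2 * (4 * (l : ℝ) + 3) * d) := by
        rw [div_le_div_iff₀ (by positivity) (by positivity), ← Real.rpow_add hS0, one_mul]
        exact Real.rpow_le_rpow_of_exponent_le hS1 hexp
    _ ≤ _ := one_div_le_one_div_of_le (by positivity) hbase

/-! ### The multivariate design matrix -/

/-- The quadratic form of the design matrix. -/
theorem dotProduct_B_mulVec (d l m : ℕ) (K : ℝ → ℝ) (h : ℝ) (x : Fin d → ℝ)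
    (v : MultiIndex d l → ℝ) :
    v ⬝ᵥ (B d l m K h x).mulVec v = (1 / ((m : ℝ) * h) ^ d) * ∑ y ∈ grid d m,
      (∏ j, K ((y j - x j) / h)) *
        (∑ s : MultiIndex d l, v s * ∏ j, ((y j - x j) / h) ^ s.1 j / (s.1 j).factorial) ^ 2 := by
  simp only [B, Matrix.smul_mulVec, dotProduct_smul, Matrix.sum_mulVec, dotProduct_sum, smul_eq_mul,
    Matrix.vecMulVec_mulVec]
  congr 1
  refine sum_congr rfl fun y _ => ?_
  congr 1
  simp only [dotProduct, U, prod_div_distrib, MulOpposite.smul_eq_mul_unop,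
    MulOpposite.unop_op, sq, sum_mul_sum]
  exact sum_congr rfl fun s _ => sum_congr rfl fun t _ => by ring

theorem isHermitian_B (d l m : ℕ) (K : ℝ → ℝ) (h : ℝ) (x : Fin d → ℝ) :
    (B d l m K h x).IsHermitian := by
  ext i j
  simp only [B, Matrix.conjTranspose_apply, Matrix.smul_apply, Matrix.sum_apply,
    Matrix.vecMulVec_apply, star_trivial, mul_comm]

theorem sum_sq_le_dotProduct_B {d l m : ℕ} {b c h : ℝ} {K : ℝ → ℝ} (hK : IsKernel b c K)
    (hm : 1 ≤ m) (hh : 0 < h) (hmh : ((l + 1 : ℕ) : ℝ) ≤ m * h) {x : Fin d → ℝ}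
    (hx : ∀ i, x i ∈ Set.Icc h (1 - h)) (v : MultiIndex d l → ℝ) :
    b ^ d * (1 / ((2 * (l + 1 : ℕ) : ℝ) ^ (4 * (l + 1) - 1)) ^ d) * ∑ s, v s ^ 2 ≤
      v ⬝ᵥ (B d l m K h x).mulVec v := by
  have hm' : (0 : ℝ) < m := by exact_mod_cast hm
  have hb := hK.b_pos
  have hKb : ∀ t ∈ Set.Icc (-1 : ℝ) 1, b ≤ K t := fun t ht => (hK.bounds t ht).1
  have hK0 : ∀ t, 0 ≤ K t := by
    intro t
    by_cases ht : t ∈ Set.Icc (-1 : ℝ) 1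
    · exact hb.le.trans (hKb t ht)
    · rw [← hK.support_eq, Function.notMem_support] at ht
      exact ht.ge
  set e : MultiIndex d l → (Fin d → Fin (l + 1)) := fun s j =>
    ⟨s.1 j, Nat.lt_succ_of_le ((single_le_sum (fun i _ => Nat.zero_le (s.1 i)) (mem_univ j)).trans
      s.2)⟩ with he
  have hinj : Function.Injective e := by
    intro s t hst
    ext j
    exact congrArg Fin.val (congrFun hst j)
  -- Zero extension turns the simplex of multi-indices into the full box, where the tensor bound
  -- applies.
  set v' : (Fin d → Fin (l + 1)) → ℝ := Function.extend e v (fun _ => 0) with hv'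
  have hv'e : ∀ s, v' (e s) = v s := fun s => hinj.extend_apply v (fun _ => 0) s
  have hv'0 : ∀ i, i ∉ Set.range e → v' i = 0 := fun i hi =>
    Function.extend_apply' v (fun _ => 0) i (by simpa using hi)
  set G : Finset ℝ := (Icc 1 m).image fun k : ℕ => (k : ℝ) / m with hG
  set A : ℝ := (2 * (l + 1 : ℕ) : ℝ) ^ (4 * (l + 1) - 1)
  have htensor := tensor_lower_bound (α := G) (σ := Fin (l + 1)) (μ := b * (m * h) / A)
    (by positivity) (fun j y => K ((y - x j) / h))
    (fun j s y => (((y : ℝ) - x j) / h) ^ (s : ℕ) / (s : ℕ).factorial) (fun j y => hK0 _)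
    (fun j w => by
      refine (univariate_lower_bound (Nat.succ_pos l) hm hb.le hK0 hKb hh hmh (hx j) w).trans_eq ?_
      exact (sum_coe_sort G fun y => K ((y - x j) / h) *
        (∑ s : Fin (l + 1), w s * (((y - x j) / h) ^ (s : ℕ) / (s : ℕ).factorial)) ^ 2).symm) v'
  have hsq : ∑ s, v' s ^ 2 = ∑ s, v s ^ 2 :=
    (Fintype.sum_of_injective e hinj _ _ (fun i hi => by simp [hv'0 i hi])
      fun s => by rw [hv'e]).symm
  have hpoly : ∀ y : Fin d → ℝ,
      ∑ s, v' s * ∏ j, ((y j - x j) / h) ^ (s j : ℕ) / (s j : ℕ).factorial =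
        ∑ s : MultiIndex d l, v s * ∏ j, ((y j - x j) / h) ^ s.1 j / (s.1 j).factorial := fun y =>
    (Fintype.sum_of_injective e hinj _ _ (fun i hi => by simp [hv'0 i hi])
      fun s => by rw [hv'e]).symm
  have hgrid : ∀ g : (Fin d → ℝ) → ℝ,
      ∑ y ∈ grid d m, g y = ∑ y : Fin d → G, g fun j => y j := by
    intro g
    symm
    refine sum_bij (fun y _ j => (y j : ℝ)) (fun y _ => Fintype.mem_piFinset.2 fun j => (y j).2)
      (fun y _ z _ hyz => funext fun j => Subtype.ext (congrFun hyz j))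
      (fun y hy => ⟨fun j => ⟨y j, Fintype.mem_piFinset.1 hy j⟩, mem_univ _, rfl⟩) fun _ _ => rfl
  rw [dotProduct_B_mulVec, hgrid]
  simp_rw [← hpoly]
  rw [hsq] at htensor
  refine le_trans (le_of_eq ?_) (mul_le_mul_of_nonneg_left htensor
    (by positivity : 0 ≤ 1 / ((m : ℝ) * h) ^ d))
  have hA : 0 < A := by positivity
  rw [div_pow, mul_pow b]
  field_simp

end LocalPoly

/-! ### Conclusion -/

theorem proposition1 (d l : ℕ) (hd : 19 ≤ d) (hl : d ≤ l) :
    0 < LocalPoly.Lam d l ∧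
    ∀ (b c : ℝ) (K : ℝ → ℝ), LocalPoly.IsKernel b c K →
    ∀ (m : ℕ) (h : ℝ), 1 ≤ m → h ∈ Set.Ioo (0 : ℝ) (1 / 2) →
      4 * (l : ℝ) * (3 * Real.exp 1) ^ d / LocalPoly.Lam d l ≤ (m : ℝ) * h →
    ∀ x : Fin d → ℝ, (∀ i, x i ∈ Set.Icc h (1 - h)) →
      (LocalPoly.B d l m K h x -
        (b ^ d * LocalPoly.Lam d l / 2) •
          (1 : Matrix (LocalPoly.MultiIndex d l) (LocalPoly.MultiIndex d l) ℝ)).PosSemidef := by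
  have hpos : 0 < LocalPoly.Lam d l := LocalPoly.Lam_pos (by omega) (by omega)
  refine ⟨hpos, fun b c K hK m h hm hh hmh x hx => ?_⟩
  have hLam := LocalPoly.Lam_le hd hl
  have hb := hK.b_pos
  have hl1 : (1 : ℝ) ≤ l := by exact_mod_cast (by omega : 1 ≤ l)
  have hA : (1 : ℝ) ≤ ((2 * (l + 1 : ℕ) : ℝ) ^ (4 * (l + 1) - 1)) ^ d :=
    one_le_pow₀ (one_le_pow₀ (by push_cast; linarith))
  have hLam1 : LocalPoly.Lam d l ≤ 1 := hLam.trans ((div_le_one (by linarith)).2 hA)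
  -- The size condition on `m * h` serves only to give `l + 1 ≤ m * h`, which follows since `Lam ≤
  -- 1`.
  have hlmh : ((l + 1 : ℕ) : ℝ) ≤ m * h := by
    refine le_trans ?_ hmh
    have h3 : (1 : ℝ) ≤ (3 * Real.exp 1) ^ d :=
      one_le_pow₀ (by linarith [Real.add_one_le_exp (1 : ℝ)])
    rw [le_div_iff₀ hpos]
    push_cast
    nlinarith
  refine Matrix.PosSemidef.of_dotProduct_mulVec_nonneg
    ((LocalPoly.isHermitian_B d l m K h x).sub ?_) fun v => ?_
  · rw [Matrix.IsHermitian, Matrix.conjTranspose_smul, Matrix.conjTranspose_one, star_trivial]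
  · have hmain := LocalPoly.sum_sq_le_dotProduct_B hK hm hh.1 hlmh hx v
    have hv : 0 ≤ ∑ s, v s ^ 2 := Finset.sum_nonneg fun _ _ => sq_nonneg _
    have hvv : v ⬝ᵥ v = ∑ s, v s ^ 2 := by simp [dotProduct, sq]
    rw [star_trivial, Matrix.sub_mulVec, dotProduct_sub, Matrix.smul_mulVec, Matrix.one_mulVec,
      dotProduct_smul, smul_eq_mul, hvv, sub_nonneg]
    refine le_trans (mul_le_mul_of_nonneg_right ?_ hv) hmain
    rw [mul_div_assoc]
    refine mul_le_mul_of_nonneg_left ?_ (by positivity)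
    linarith
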